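/- Let $q\in\mathbb N$ and let all matrices below be complex $q\times q$ matrices unless said otherwise; $A^\dagger$ denotes the Moore–Penrose inverse of a complex matrix $A$. **Classes.** For a sequence $(s_j)$ and $n\ge 0$ put $H_n^{\langle s\rangle}=[s_{j+k}]_{j,k=0}^n$ (block Hankel matrix). For $\alpha\in\mathbb R$ and a sequence $(s_j)_{j=0}^m$ with $m\ge1$ put $s_{\alpha\triangleright j}=-\alpha s_j+s_{j+1}$ ($0\le j\le m-1$), the right-sided $\alpha$-shift $s_{\alpha\triangleright}$ of $s$. The class $\mathcal K^{\ge}_{q,m,\alpha}$ is the set of all sequences $(s_j)_{j=0}^m$ such that: if $m=2n$, then $H_n^{\langle s\rangle}$ and, in case $n\ge1$, also $H_{n-1}^{\langle s_{\alpha\triangleright}\rangle}$ are non-negative Hermitian; if $m=2n+1$, then $H_n^{\langle s\rangle}$ and $H_n^{\langle s_{\alpha\triangleright}\rangle}$ are non-negative Hermitian. **Parametrization.** Put $L_0^{\langle s\rangle}=s_0$ and, for $n\ge1$, $$L_n^{\langle s\rangle}=s_{2n}-[s_n,\dots,s_{2n-1}]\,(H_{n-1}^{\langle s\rangle})^\dagger\begin{bmatrix}s_n\\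 \vdots\\ s_{2n-1}\end{bmatrix}.$$ The right-sided $\alpha$-Stieltjes parametrization of $(s_j)_{j=0}^m$ is the sequence $(Q_j)_{j=0}^m$ with $Q_{2k}=L_k^{\langle s\rangle}$ for $2k\le m$ and $Q_{2k+1}=L_k^{\langle s_{\alpha\triangleright}\rangle}$ for $2k+1\le m$. **Schur-type transform.** For a sequence $(u_j)_{j=0}^m$ its reciprocal sequence $(u_j^\sharp)_{j=0}^m$ is given by $u_0^\sharp=u_0^\dagger$ and $u_j^\sharp=-u_0^\dagger\sum_{l=0}^{j-1}u_{j-l}u_l^\sharp$ for $j\ge1$. For a sequence $(s_j)_{j=0}^m$ with $m\ge1$ let $u_0=s_0$ and $u_j=-\alpha s_{j-1}+s_j$ for $1\le j\le m$. The first $\alpha$-Schur transform of $(s_j)_{j=0}^m$ is the sequence $(-s_0u_{j+1}^\sharp s_0)_{j=0}^{m-1}$. The $0$-th $\alpha$-Schur transform of $(s_j)_{j=0}^m$ is the sequence itself and, for $1\le k\le m$, the $k$-th $\alpha$-Schur transform is the first $\alpha$-Schur transform of the $(k-1)$-th one; it is denoted by $(s_j^{[k,\alpha]})_{j=0}^{m-k}$.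 For $0\le k\le m$ and $0\le j\le m-k$ put $$P_{j,k}=s_j^{[k,\alpha]}-s_0^{[k,\alpha]}(s_0^{[k,\alpha]})^\dagger s_j^{[k,\alpha]}(s_0^{[k,\alpha]})^\dagger s_0^{[k,\alpha]}.$$ **Theorem.** Let $\alpha\in\mathbb R$, let $m\ge0$ be an integer, let $(s_j)_{j=0}^m\in\mathcal K^{\ge}_{q,m,\alpha}$, and let $0\le k\le m$. Let $(Q_j)_{j=0}^m$ be the right-sided $\alpha$-Stieltjes parametrization of $(s_j)_{j=0}^m$ and let $(T_j)_{j=0}^{m-k}$ be the right-sided $\alpha$-Stieltjes parametrization of the $k$-th $\alpha$-Schur transform $(s_j^{[k,\alpha]})_{j=0}^{m-k}$. Then $T_j=Q_{k+j}$ for all integers $j$ with $0\le j<m-k$, and $$T_{m-k}=Q_m-\sum_{r=0}^{k-1}P_{m-r,r},$$ where the sum is empty, i.e. $T_m=Q_m$, in the case $k=0$. -/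

import Mathlib

open Matrix
open scoped BigOperators ComplexOrder

namespace StieltjesSchur

/-! ### The Moore-Penrose inverse of a complex matrix -/

section MoorePenrose

variable {m n : Type*} [Fintype m] [Fintype n]

/-- `X` satisfies the four Penrose equations for `A`. -/
structure IsMoorePenrose (A : Matrix m n ℂ) (X : Matrix n m ℂ) : Prop where
  mul_mul_left : A * X * A = A
  mul_mul_right : X * A * X = X
  hermitian_left : (A * X)ᴴ = A * X
  hermitian_right : (X * A)ᴴ = X * A

theorem IsMoorePenrose.unique {A : Matrix m n ℂ} {X Y : Matrix n m ℂ}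
    (hX : IsMoorePenrose A X) (hY : IsMoorePenrose A Y) : X = Y := by
  have h1 : A * X = A * Y := by
    calc A * X = (A * Y * A) * X := by rw [hY.mul_mul_left]
      _ = (A * Y)ᴴ * (A * X)ᴴ := by
          rw [hY.hermitian_left, hX.hermitian_left, Matrix.mul_assoc (A * Y)]
      _ = (A * X * A * Y)ᴴ := by rw [← conjTranspose_mul, ← Matrix.mul_assoc]
      _ = A * Y := by rw [hX.mul_mul_left, hY.hermitian_left]
  have h2 : X * A = Y * A := by
    calc X * A = X * (A * Y * A) := by rw [hY.mul_mul_left]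
      _ = (X * A)ᴴ * (Y * A)ᴴ := by
          rw [hY.hermitian_right, hX.hermitian_right, Matrix.mul_assoc A, ← Matrix.mul_assoc X]
      _ = (Y * (A * X * A))ᴴ := by
          rw [← conjTranspose_mul, Matrix.mul_assoc A, ← Matrix.mul_assoc Y]
      _ = Y * A := by rw [hX.mul_mul_left, hY.hermitian_right]
  calc X = X * A * X := hX.mul_mul_right.symm
    _ = Y * A * X := by rw [h2]
    _ = Y * (A * X) := Matrix.mul_assoc _ _ _
    _ = Y * A * Y := by rw [h1, Matrix.mul_assoc]
    _ = Y := hY.mul_mul_right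

theorem exists_isMoorePenrose [DecidableEq n] (A : Matrix m n ℂ) :
    ∃ X : Matrix n m ℂ, IsMoorePenrose A X := by
  have hB : (Aᴴ * A).IsHermitian := isHermitian_conjTranspose_mul_self A
  obtain ⟨U, d, hU, hS⟩ : ∃ (U : Matrix n n ℂ) (d : n → ℝ), Uᴴ * U = 1 ∧
      Aᴴ * A = U * diagonal (fun i => (d i : ℂ)) * Uᴴ := by
    refine ⟨(hB.eigenvectorUnitary : Matrix n n ℂ), hB.eigenvalues, ?_, ?_⟩
    · exact (Matrix.mem_unitaryGroup_iff'.1 hB.eigenvectorUnitary.2)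
    · have := hB.spectral_theorem
      rw [Unitary.conjStarAlgAut_apply] at this
      exact this
  set D : Matrix n n ℂ := diagonal (fun i => (d i : ℂ)) with hD
  set E : Matrix n n ℂ := diagonal (fun i => ((d i)⁻¹ : ℂ)) with hE
  have hDED : D * E * D = D := by
    simp only [hD, hE, diagonal_mul_diagonal]
    congr 1; funext i
    by_cases h : (d i : ℂ) = 0
    · simp [h]
    · field_simp
  have hEDE : E * D * E = E := by
    simp only [hD, hE, diagonal_mul_diagonal]
    congr 1; funext i
    by_cases h : (d i : ℂ) = 0
    · simp [h]
    · field_simp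
  have hEstar : Eᴴ = E := by
    simp only [hE, diagonal_conjTranspose]
    congr 1; funext i; simp
  have hcomm : E * D = D * E := by
    simp only [hD, hE, diagonal_mul_diagonal]
    congr 1; funext i; ring
  have hDstar : Dᴴ = D := by
    simp only [hD, diagonal_conjTranspose]
    congr 1; funext i; simp
  -- `P` is the Moore-Penrose inverse of `Aᴴ * A`
  obtain ⟨P, hPdef⟩ : ∃ P : Matrix n n ℂ, P = U * E * Uᴴ := ⟨_, rfl⟩
  have hPs : Pᴴ = P := by
    rw [hPdef]; simp [conjTranspose_mul, hEstar, Matrix.mul_assoc]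
  have key : ∀ X Y : Matrix n n ℂ, (U * X * Uᴴ) * (U * Y * Uᴴ) = U * (X * Y) * Uᴴ := by
    intro X Y
    calc (U * X * Uᴴ) * (U * Y * Uᴴ) = U * X * (Uᴴ * U) * Y * Uᴴ := by
          simp only [Matrix.mul_assoc]
      _ = U * (X * Y) * Uᴴ := by rw [hU]; simp only [Matrix.mul_assoc, Matrix.one_mul]
  have hBPB : (Aᴴ * A) * P * (Aᴴ * A) = Aᴴ * A := by
    rw [hS, hPdef, key, key, hDED]
  have hPBP : P * (Aᴴ * A) * P = P := by
    rw [hS, hPdef, key, key, hEDE]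
  have hPB : (P * (Aᴴ * A))ᴴ = P * (Aᴴ * A) := by
    rw [hS, hPdef, key, conjTranspose_mul, conjTranspose_mul, conjTranspose_conjTranspose,
      conjTranspose_mul, hDstar, hEstar, ← hcomm]
    simp only [Matrix.mul_assoc]
  have hPA : A * P * (Aᴴ * A) = A := by
    rw [← sub_eq_zero, ← Matrix.conjTranspose_mul_self_eq_zero]
    have h0 : Aᴴ * (A * P * (Aᴴ * A) - A) = 0 := by
      rw [Matrix.mul_sub, sub_eq_zero]
      calc Aᴴ * (A * P * (Aᴴ * A)) = (Aᴴ * A) * P * (Aᴴ * A) := by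
            simp only [Matrix.mul_assoc]
        _ = Aᴴ * A := hBPB
    have h1 : (A * P * (Aᴴ * A) - A)ᴴ = (P * (Aᴴ * A) - 1)ᴴ * Aᴴ := by
      rw [← conjTranspose_mul]
      congr 1
      rw [Matrix.mul_sub, Matrix.mul_one, Matrix.mul_assoc]
    rw [h1, Matrix.mul_assoc, h0, Matrix.mul_zero]
  refine ⟨P * Aᴴ, ?_, ?_, ?_, ?_⟩
  · calc A * (P * Aᴴ) * A = A * P * (Aᴴ * A) := by simp only [Matrix.mul_assoc]
      _ = A := hPA
  · calc P * Aᴴ * A * (P * Aᴴ) = (P * (Aᴴ * A) * P) * Aᴴ := by simp only [Matrix.mul_assoc]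
      _ = P * Aᴴ := by rw [hPBP]
  · simp [conjTranspose_mul, hPs, Matrix.mul_assoc]
  · rw [Matrix.mul_assoc]; exact hPB

/-- The Moore-Penrose inverse `A†` of a complex matrix `A`. -/
noncomputable def mpInv [DecidableEq n] (A : Matrix m n ℂ) : Matrix n m ℂ :=
  (exists_isMoorePenrose A).choose

theorem mpInv_spec [DecidableEq n] (A : Matrix m n ℂ) : IsMoorePenrose A (mpInv A) :=
  (exists_isMoorePenrose A).choose_spec

end MoorePenrose

/-! ### Sequences of complex matrices

A sequence `(s_j)_{j=0}^m` is represented by a function `s : ℕ → Matrix _ _ ℂ`, of which only the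
values `s 0, …, s m` are relevant: every notion below for `(s_j)_{j=0}^m` involves only these
values. -/

section Sequences

variable {p q : ℕ}

/-- The block Hankel matrix `H_n = [s_{j+k}]_{j,k=0}^n`. -/
def blockHankel (s : ℕ → Matrix (Fin p) (Fin q) ℂ) (n : ℕ) :
    Matrix (Fin (n + 1) × Fin p) (Fin (n + 1) × Fin q) ℂ :=
  fun a b => s ((a.1 : ℕ) + (b.1 : ℕ)) a.2 b.2

/-- The block column with `n` blocks `s_l, s_{l+1}, …, s_{l+n-1}`. -/
def blockCol (s : ℕ → Matrix (Fin p) (Fin q) ℂ) (l n : ℕ) : Matrix (Fin n × Fin p) (Fin q) ℂ :=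
  fun a j => s (l + (a.1 : ℕ)) a.2 j

/-- The block row with `n` blocks `s_l, s_{l+1}, …, s_{l+n-1}`. -/
def blockRow (s : ℕ → Matrix (Fin p) (Fin q) ℂ) (l n : ℕ) : Matrix (Fin p) (Fin n × Fin q) ℂ :=
  fun i b => s (l + (b.1 : ℕ)) i b.2

/-- The sequence `-α s_j + s_{j+1}` generated from `s` by right-sided `α`-shifting. -/
def rightShift (α : ℂ) (s : ℕ → Matrix (Fin p) (Fin q) ℂ) : ℕ → Matrix (Fin p) (Fin q) ℂ :=
  fun j => -(α • s j) + s (j + 1)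

/-- `(s_j)_{j=0}^{2n}` is Hankel non-negative definite. -/
def HankelNonneg (n : ℕ) (s : ℕ → Matrix (Fin q) (Fin q) ℂ) : Prop :=
  (blockHankel s n).PosSemidef

/-- The class `K^≥_{q,m,α}` of `α`-Stieltjes (right-sided) non-negative definite sequences
`(s_j)_{j=0}^m` of complex `q × q` matrices. -/
def StieltjesNonneg (α : ℝ) (m : ℕ) (s : ℕ → Matrix (Fin q) (Fin q) ℂ) : Prop :=
  (∀ n, m = 2 * n →
    HankelNonneg n s ∧ (1 ≤ n → HankelNonneg (n - 1) (rightShift (α : ℂ) s))) ∧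
  (∀ n, m = 2 * n + 1 → HankelNonneg n s ∧ HankelNonneg n (rightShift (α : ℂ) s))

/-- `L_0 = s_0` and `L_n = s_{2n} - [s_n, …, s_{2n-1}] H_{n-1}† col(s_n, …, s_{2n-1})`
for `n ≥ 1`. -/
noncomputable def schurCompl (s : ℕ → Matrix (Fin p) (Fin q) ℂ) : ℕ → Matrix (Fin p) (Fin q) ℂ
  | 0 => s 0
  | n + 1 => s (2 * (n + 1)) -
      blockRow s (n + 1) (n + 1) * mpInv (blockHankel s n) * blockCol s (n + 1) (n + 1)

/-- The right-sided `α`-Stieltjes parametrization: `Q_{2k} = L_k` and `Q_{2k+1}` is `L_k` formed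
from the right-sided `α`-shift of `s`. -/
noncomputable def stieltjesParam (α : ℂ) (s : ℕ → Matrix (Fin p) (Fin q) ℂ) (j : ℕ) :
    Matrix (Fin p) (Fin q) ℂ :=
  if Even j then schurCompl s (j / 2) else schurCompl (rightShift α s) (j / 2)

/-- The reciprocal sequence: `r_0 = s_0†` and `r_j = -s_0† ∑_{l=0}^{j-1} s_{j-l} r_l`. -/
noncomputable def recipSeq (s : ℕ → Matrix (Fin p) (Fin q) ℂ) : ℕ → Matrix (Fin q) (Fin p) ℂ
  | 0 => mpInv (s 0)
  | j + 1 => -(mpInv (s 0) * ∑ l : Fin (j + 1), s (j + 1 - (l : ℕ)) * recipSeq s (l : ℕ))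
decreasing_by exact l.isLt

/-- The `(+,α)`-transform: `-α s_{j-1} + s_j` with `s_{-1} = 0`. -/
def plusTransform (α : ℂ) (s : ℕ → Matrix (Fin p) (Fin q) ℂ) : ℕ → Matrix (Fin p) (Fin q) ℂ
  | 0 => s 0
  | j + 1 => -(α • s j) + s (j + 1)

/-- The first `α`-Schur transform `s_0 (-r_{j+1}) s_0`, where `r` is the reciprocal sequence of
the `(+,α)`-transform of `s`. -/
noncomputable def schurTransform (α : ℂ) (s : ℕ → Matrix (Fin p) (Fin q) ℂ) :
    ℕ → Matrix (Fin p) (Fin q) ℂ :=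
  fun j => s 0 * (-(recipSeq (plusTransform α s) (j + 1))) * s 0

/-- The `k`-th `α`-Schur transform; for `(s_j)_{j=0}^m` with `k ≤ m` it has the entries
`0, …, m - k`. -/
noncomputable def schurIter (α : ℂ) (s : ℕ → Matrix (Fin p) (Fin q) ℂ) :
    ℕ → ℕ → Matrix (Fin p) (Fin q) ℂ
  | 0 => s
  | k + 1 => schurTransform α (schurIter α s k)

/-- `P_{j,k} = t_j - t_0 t_0† t_j t_0† t_0`, where `t` is the `k`-th `α`-Schur transform. -/
noncomputable def defectTerm (α : ℂ) (s : ℕ → Matrix (Fin p) (Fin q) ℂ) (j k : ℕ) :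
    Matrix (Fin p) (Fin q) ℂ :=
  schurIter α s k j -
    schurIter α s k 0 * mpInv (schurIter α s k 0) * schurIter α s k j *
      mpInv (schurIter α s k 0) * schurIter α s k 0

end Sequences

end StieltjesSchur

/-!
The infinite block Hankel matrix of a sequence `a` has the generating function
`H(z, w) = ∑ a_{j+k} z^j w^k`, and `(z - w) H(z, w) = z a(z) - w a(w)`. Suppose first that all `s_j`
are Hermitian with range in that of `s_0`. Let `u(z) = (1 - α z) s(z) = s_0 + z a(z)`, where `a` is
the `α`-shift of `s`, and let `G` be the reciprocal series of `u`, normalized so that `G(0) = 1` and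
`u G = s_0`. Then `s_0 G(z) = s_0 - z t(z)` for the Schur transform `t` of `s`, and the identity
above shows that `G(z)* H_a(z, w) G(w)` is the generating function of the Hankel matrix of `t`. In
the same way, the reciprocal series of `s` itself turns the Hankel matrix of `s` into
`diag(s_0, H_b)`, where `b` is the `α`-shift of `t`. On finite sections these are congruences by
unipotent block Toeplitz matrices. They preserve non-negativity and the Schur complement of the last
diagonal block, so the Stieltjes parameters of `t` are those of `s`, moved by one index.

For a general `α`-Stieltjes non-negative sequence `s_0, …, s_m`, the range condition can fail only
for `s_m`. Compressing the sequence to the range of `s_0` leaves its Schur transform unchanged, and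
it changes only the last parameter, by `P_{m,0}`.
-/

namespace StieltjesSchur

section GeneratingFunctions

open PowerSeries

variable {R : Type*} [Ring R]

/-- The bivariate generating function `∑ a_{j+k} z^j w^k` of the infinite Hankel matrix of `a`.
The inner variable `z` is `C X`, the outer variable `w` is `X`; accordingly `C F` and
`PowerSeries.map C G` stand for `F(z)` and `G(w)`. -/
noncomputable def hankelSeries (a : ℕ → R) : R⟦X⟧⟦X⟧ :=
  mk fun k => mk fun j => a (j + k)

theorem commute_C_X (Φ : R⟦X⟧⟦X⟧) : Commute (C X) Φ := by
  ext k : 1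
  rw [coeff_C_mul, coeff_mul_C, (commute_X _).eq]

theorem C_X_sub_X_mul_hankelSeries (a : ℕ → R) :
    (C X - X) * hankelSeries a = C (X * mk a) - PowerSeries.map C (X * mk a) := by
  ext k : 1
  rw [sub_mul, map_sub, map_sub, coeff_C_mul, coeff_map, hankelSeries, coeff_mk]
  rcases k with - | k
  · simp
  · ext (- | j)
    · simp
    · simp [coeff_succ_X_mul, add_right_comm j, add_assoc]

theorem C_X_sub_X_mul_cancel {Φ Ψ : R⟦X⟧⟦X⟧} (h : (C X - X) * Φ = (C X - X) * Ψ) : Φ = Ψ := by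
  have h' (k : ℕ) := congrArg (coeff k) h
  simp only [sub_mul, map_sub, coeff_C_mul] at h'
  ext k : 1
  induction k with
  | zero => exact X_mul_cancel (by simpa using h' 0)
  | succ k ih => exact X_mul_cancel (by simpa [coeff_succ_X_mul, ih] using h' (k + 1))

theorem C_X_sub_X_mul_mul_hankelSeries_mul (F G : R⟦X⟧) (a : ℕ → R) :
    (C X - X) * (C F * hankelSeries a * PowerSeries.map C G) =
      C F * (C (X * mk a) - PowerSeries.map C (X * mk a)) * PowerSeries.map C G := by
  have hF : Commute (C X - X) (C F) := (commute_C_X _).sub_left (commute_X _).symm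
  rw [← C_X_sub_X_mul_hankelSeries, ← mul_assoc, ← mul_assoc, hF.eq, mul_assoc (C F)]

theorem mul_hankelSeries_mul_of_add_X_mul {c : R} {a t : ℕ → R} {F G : R⟦X⟧}
    (hF : F * (C c + X * mk a) = C c) (hG : (C c + X * mk a) * G = C c)
    (ht : C c * G = C c - X * mk t) :
    C F * hankelSeries a * PowerSeries.map C G = hankelSeries t := by
  refine C_X_sub_X_mul_cancel ?_
  have hFG : F * C c = C c * G := by rw [← hF, mul_assoc, hG, hF]
  have hU : C (X * mk a) - PowerSeries.map C (X * mk a) =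
      C (C c + X * mk a) - PowerSeries.map C (C c + X * mk a) := by
    simp only [map_add, map_C, add_sub_add_left_eq_sub]
  calc (C X - X) * (C F * hankelSeries a * PowerSeries.map C G)
      = C (F * (C c + X * mk a)) * PowerSeries.map C G -
          C F * PowerSeries.map C ((C c + X * mk a) * G) := by
        rw [C_X_sub_X_mul_mul_hankelSeries_mul, hU, mul_sub, sub_mul, map_mul, map_mul]
        simp only [mul_assoc]
    _ = PowerSeries.map C (C c * G) - C (F * C c) := by
        rw [hF, hG, map_mul, map_mul, map_C]
    _ = (C X - X) * hankelSeries t := by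
        rw [hFG, ht, C_X_sub_X_mul_hankelSeries, map_sub, map_sub, map_C]
        abel

theorem mul_hankelSeries_mul_of_mul_mk {c d : R} {s b : ℕ → R} {F G : R⟦X⟧}
    (hF : F * mk s = C c) (hG : mk s * G = C c)
    (hb : C c * G = C c - X * C d - X ^ 2 * mk b) :
    C F * hankelSeries s * PowerSeries.map C G = C (C c) + C X * X * hankelSeries b := by
  refine C_X_sub_X_mul_cancel ?_
  have hFG : F * C c = C c * G := by rw [← hF, mul_assoc, hG, hF]
  have hX (F : R⟦X⟧) (Φ : R⟦X⟧⟦X⟧) : C F * (X * Φ) = X * (C F * Φ) :=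
    (commute_X _).left_comm Φ
  calc (C X - X) * (C F * hankelSeries s * PowerSeries.map C G)
      = C X * C (F * mk s) * PowerSeries.map C G -
          X * (C F * PowerSeries.map C (mk s * G)) := by
        rw [C_X_sub_X_mul_mul_hankelSeries_mul, mul_sub, sub_mul, ← map_mul,
          (commute_X F).left_comm, map_mul C X, map_mul _ X, PowerSeries.map_X, hX,
          map_mul _ (mk s)]
        simp only [mul_assoc]
    _ = C X * PowerSeries.map C (C c * G) - X * C (F * C c) := by
        rw [hF, hG, map_mul, map_mul, map_C, mul_assoc]
    _ = (C X - X) * C (C c) + C X * X * (C (X * mk b) - PowerSeries.map C (X * mk b)) := by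
        rw [hFG, hb]
        simp only [map_sub, map_mul, map_C, PowerSeries.map_X, mul_sub, sub_mul, pow_two,
          mul_assoc, hX]
        abel
    _ = (C X - X) * (C (C c) + C X * X * hankelSeries b) := by
        have hcomm := (commute_C_X (C X - X : R⟦X⟧⟦X⟧)).mul_left (commute_X (C X - X)).symm
        rw [← C_X_sub_X_mul_hankelSeries, mul_add, hcomm.left_comm]

/-- The leading `N × N` block of the infinite matrix whose generating function is `Φ`; the row
index is the inner degree and the column index the outer degree. -/
noncomputable def truncMatrix (N : ℕ) (Φ : R⟦X⟧⟦X⟧) : Matrix (Fin N) (Fin N) R :=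
  of fun j k => coeff j (coeff k Φ)

/-- The leading `N × N` block of the lower triangular Toeplitz matrix of `F`, that is, of
multiplication by `F` on coefficient vectors. -/
noncomputable def toeplitz (N : ℕ) (F : R⟦X⟧) : Matrix (Fin N) (Fin N) R :=
  of fun i j => coeff i (F * X ^ (j : ℕ))

theorem sum_fin_ite_eq_sum_antidiagonal {M : Type*} [AddCommMonoid M] {N k : ℕ} (hk : k < N)
    (f : ℕ × ℕ → M) :
    ∑ l : Fin N, (if (l : ℕ) ≤ k then f (k - l, l) else 0) =
      ∑ p ∈ Finset.HasAntidiagonal.antidiagonal k, f p := by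
  have hfilter : {l ∈ Finset.range N | l ≤ k} = Finset.range (k + 1) := by grind
  rw [Fin.sum_univ_eq_sum_range (fun l => if l ≤ k then f (k - l, l) else 0) N,
    ← Finset.sum_filter, hfilter, ← Finset.Nat.sum_antidiagonal_swap,
    Finset.Nat.sum_antidiagonal_eq_sum_range_succ_mk]
  rfl

theorem toeplitz_apply (N : ℕ) (F : R⟦X⟧) (i j : Fin N) :
    toeplitz N F i j = if (j : ℕ) ≤ i then coeff (i - j) F else 0 := by
  rw [toeplitz, of_apply, coeff_mul_X_pow']

theorem truncMatrix_C_mul (N : ℕ) (F : R⟦X⟧) (Φ : R⟦X⟧⟦X⟧) :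
    truncMatrix N (C F * Φ) = toeplitz N F * truncMatrix N Φ := by
  ext j k
  simp only [mul_apply, toeplitz_apply, ite_mul, zero_mul]
  rw [truncMatrix, of_apply, coeff_C_mul, coeff_mul]
  exact (sum_fin_ite_eq_sum_antidiagonal j.isLt
    fun p => coeff p.1 F * coeff p.2 (coeff k Φ)).symm

theorem truncMatrix_mul_map_C (N : ℕ) (Φ : R⟦X⟧⟦X⟧) (G : R⟦X⟧) :
    truncMatrix N (Φ * PowerSeries.map C G) = truncMatrix N Φ * (toeplitz N G)ᵀ := by
  ext j k
  simp only [mul_apply, transpose_apply, toeplitz_apply, mul_ite, mul_zero]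
  rw [truncMatrix, of_apply, coeff_mul, map_sum, ← Finset.Nat.sum_antidiagonal_swap]
  simp only [coeff_map, coeff_mul_C]
  exact (sum_fin_ite_eq_sum_antidiagonal k.isLt
    fun p => coeff j (coeff p.2 Φ) * coeff p.1 G).symm

theorem toeplitz_mul (N : ℕ) (F G : R⟦X⟧) :
    toeplitz N (F * G) = toeplitz N F * toeplitz N G := by
  have h := truncMatrix_C_mul N F (mk fun k => G * X ^ k)
  simp only [truncMatrix, coeff_C_mul, coeff_mk, ← mul_assoc F] at h
  exact h

theorem toeplitz_one (N : ℕ) : toeplitz N (1 : R⟦X⟧) = 1 := by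
  ext i j
  simp [toeplitz, coeff_X_pow, Matrix.one_apply, Fin.ext_iff]

theorem toeplitz_apply_last (n : ℕ) (F : R⟦X⟧) (i : Fin (n + 1)) :
    toeplitz (n + 1) F i (Fin.last n) = if i = Fin.last n then coeff 0 F else 0 := by
  rcases eq_or_ne i (Fin.last n) with rfl | hi
  · simp [toeplitz_apply]
  · rw [toeplitz_apply, if_neg (by grind), if_neg hi]

theorem toeplitz_mulVec_injective (N : ℕ) {F : R⟦X⟧} (hF : coeff 0 F = 1) :
    Function.Injective (toeplitz N F).mulVec := by
  have h : toeplitz N (invOfUnit F 1) * toeplitz N F = 1 := by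
    rw [← toeplitz_mul, invOfUnit_mul F 1 (by simpa using hF), toeplitz_one]
  intro v w hvw
  simpa [mulVec_mulVec, h] using congrArg (toeplitz N (invOfUnit F 1) *ᵥ ·) hvw

/-- `S` is the Schur complement of the last diagonal entry of `M`: clearing the last column of `M`
by means of the preceding ones leaves `S` in the last row and zeros elsewhere. Defining it through
the column operation avoids inverting the leading block of `M`. -/
def IsSchurComplement {n : ℕ} (M : Matrix (Fin (n + 1)) (Fin (n + 1)) R) (S : R) : Prop :=
  ∃ Y : Fin (n + 1) → R, Y (Fin.last n) = 1 ∧ M *ᵥ Y = Pi.single (Fin.last n) S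

theorem IsSchurComplement.of_mul_mul {n : ℕ} {Φ : R⟦X⟧⟦X⟧} {F G : R⟦X⟧} {S : R}
    (hF : coeff 0 F = 1) (hG : coeff 0 G = 1)
    (h : IsSchurComplement (truncMatrix (n + 1) (C F * Φ * PowerSeries.map C G)) S) :
    IsSchurComplement (truncMatrix (n + 1) Φ) S := by
  obtain ⟨Y, hY, hMY⟩ := h
  refine ⟨(toeplitz (n + 1) G)ᵀ *ᵥ Y, ?_, toeplitz_mulVec_injective _ hF ?_⟩
  · simp [mulVec, dotProduct, toeplitz_apply_last, hG, hY]
  · rw [truncMatrix_mul_map_C, truncMatrix_C_mul, ← mulVec_mulVec, ← mulVec_mulVec] at hMY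
    rw [hMY]
    ext i
    simp [toeplitz_apply_last, hF, mulVec_single, Pi.single_apply]

theorem IsSchurComplement.of_submatrix_succ {n : ℕ}
    {M : Matrix (Fin (n + 2)) (Fin (n + 2)) R} {S : R} (hM : ∀ k : Fin (n + 1), M 0 k.succ = 0)
    (h : IsSchurComplement (M.submatrix Fin.succ Fin.succ) S) : IsSchurComplement M S := by
  obtain ⟨Y, hY, hMY⟩ := h
  refine ⟨Fin.cons 0 Y, by rw [← Fin.succ_last, Fin.cons_succ, hY], funext fun i => ?_⟩
  rw [mulVec, dotProduct, Fin.sum_univ_succ, Fin.cons_zero, mul_zero, zero_add]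
  simp only [Fin.cons_succ]
  cases i using Fin.cases with
  | zero => simp [hM, ← Fin.succ_last]
  | succ i =>
    rw [← Fin.succ_last]
    simpa [mulVec, dotProduct, Pi.single_apply] using congrFun hMY i

section StarRing

variable [StarRing R]

theorem IsSchurComplement.unique {n : ℕ} {M : Matrix (Fin (n + 1)) (Fin (n + 1)) R} {S S' : R}
    (hM : M.IsHermitian) (h : IsSchurComplement M S) (h' : IsSchurComplement M S') : S = S' := by
  obtain ⟨Y, hY, hMY⟩ := h
  obtain ⟨Y', hY', hMY'⟩ := h'
  have hform (Z W : Fin (n + 1) → R) (hZ : Z (Fin.last n) = 1) {T : R}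
      (hMW : M *ᵥ W = Pi.single (Fin.last n) T) : star Z ⬝ᵥ M *ᵥ W = T := by
    rw [hMW, dotProduct_single, Pi.star_apply, hZ, star_one, one_mul]
  have hsymm (Z W : Fin (n + 1) → R) : star Z ⬝ᵥ M *ᵥ W = star (star W ⬝ᵥ M *ᵥ Z) := by
    rw [star_dotProduct, star_mulVec, hM.eq, dotProduct_mulVec]
  -- The form `Y'* M Y` is `S` when `M` is applied to `Y`, and `S'` when it is applied to `Y'`.
  calc S = star S := by rw [← hform Y Y hY hMY, ← hsymm]
    _ = star (star Y' ⬝ᵥ M *ᵥ Y) := by rw [hform Y' Y hY' hMY]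
    _ = star Y ⬝ᵥ M *ᵥ Y' := (hsymm Y Y').symm
    _ = S' := hform Y Y' hY hMY'

/-- The series with adjoint coefficients; the formal variable is real. -/
noncomputable def starSeries (F : R⟦X⟧) : R⟦X⟧ :=
  mk fun j => star (coeff j F)

theorem starSeries_mul (F G : R⟦X⟧) : starSeries (F * G) = starSeries G * starSeries F := by
  ext j
  simp only [starSeries, coeff_mk, coeff_mul, star_sum, star_mul]
  rw [← Finset.Nat.sum_antidiagonal_swap]
  rfl

theorem starSeries_C (c : R) : starSeries (C c) = C (star c) := by
  ext j
  rw [starSeries, coeff_mk, coeff_C, coeff_C, apply_ite star, star_zero]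

theorem transpose_toeplitz (N : ℕ) (F : R⟦X⟧) :
    (toeplitz N F)ᵀ = (toeplitz N (starSeries F))ᴴ := by
  ext i j
  simp [toeplitz_apply, starSeries, apply_ite star]

end StarRing

end GeneratingFunctions

section PosSemidef

variable {m n k l : Type*} [Fintype n]

theorem isHermitian_mpInv [DecidableEq n] {A : Matrix n n ℂ} (hA : A.IsHermitian) :
    (mpInv A).IsHermitian := by
  have h := mpInv_spec A
  have hleft : (mpInv A)ᴴ * A = A * mpInv A := by
    rw [← h.hermitian_left, conjTranspose_mul, hA.eq]
  have hright : A * (mpInv A)ᴴ = mpInv A * A := by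
    rw [← h.hermitian_right, conjTranspose_mul, hA.eq]
  refine IsMoorePenrose.unique (A := A) ⟨?_, ?_, ?_, ?_⟩ h
  · simpa [conjTranspose_mul, hA.eq, Matrix.mul_assoc] using congrArg conjTranspose h.mul_mul_left
  · simpa [conjTranspose_mul, hA.eq, Matrix.mul_assoc] using congrArg conjTranspose h.mul_mul_right
  · rw [hright, h.hermitian_right]
  · rw [hleft, h.hermitian_left]

theorem mul_mpInv_comm_of_isHermitian [DecidableEq n] {A : Matrix n n ℂ} (hA : A.IsHermitian) :
    A * mpInv A = mpInv A * A := by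
  rw [← (mpInv_spec A).hermitian_left, conjTranspose_mul, hA.eq, (isHermitian_mpInv hA).eq]

open scoped MatrixOrder in
theorem exists_eq_conjTranspose_mul_self_of_posSemidef {M : Matrix n n ℂ}
    (hM : M.PosSemidef) : ∃ D : Matrix n n ℂ, M = Dᴴ * D := by
  classical exact CStarAlgebra.nonneg_iff_eq_star_mul_self.1 hM.nonneg

theorem submatrix_mul_eq_zero_of_posSemidef [Finite m] {M : Matrix m m ℂ} (hM : M.PosSemidef)
    {φ : n → m} {P : Matrix n k ℂ} (hP : M.submatrix φ φ * P = 0) (ψ : l → m) :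
    M.submatrix ψ φ * P = 0 := by
  have := Fintype.ofFinite m
  obtain ⟨D, rfl⟩ := exists_eq_conjTranspose_mul_self_of_posSemidef hM
  rw [submatrix_mul _ _ φ id φ Function.bijective_id, ← conjTranspose_submatrix,
    conjTranspose_mul_self_mul_eq_zero] at hP
  rw [submatrix_mul _ _ ψ id φ Function.bijective_id, Matrix.mul_assoc, hP, Matrix.mul_zero]

theorem submatrix_mul_mpInv_mul_of_posSemidef [Finite m] [DecidableEq n] {M : Matrix m m ℂ}
    (hM : M.PosSemidef) (φ : n → m) (ψ : k → m) :
    M.submatrix φ φ * mpInv (M.submatrix φ φ) * M.submatrix φ ψ = M.submatrix φ ψ := by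
  set A := M.submatrix φ φ with hA
  have hAA : A * (A * mpInv A) = A := by
    rw [mul_mpInv_comm_of_isHermitian (hM.isHermitian.submatrix φ), ← Matrix.mul_assoc,
      (mpInv_spec A).mul_mul_left]
  have hrow : M.submatrix ψ φ * (1 - A * mpInv A) = 0 :=
    submatrix_mul_eq_zero_of_posSemidef hM
      (by rw [← hA, Matrix.mul_sub, Matrix.mul_one, hAA, sub_self]) ψ
  have hcol : (1 - A * mpInv A) * M.submatrix φ ψ = 0 := by
    simpa [conjTranspose_mul, (mpInv_spec A).hermitian_left, hM.isHermitian.eq] using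
      congrArg conjTranspose hrow
  rw [Matrix.sub_mul, Matrix.one_mul, sub_eq_zero] at hcol
  exact hcol.symm

end PosSemidef

section Hankel

open PowerSeries

variable {q : ℕ}

theorem blockHankel_eq_comp (s : ℕ → Matrix (Fin q) (Fin q) ℂ) (n : ℕ) :
    blockHankel s n = comp _ _ _ _ _ (truncMatrix (n + 1) (hankelSeries s)) := by
  ext a b
  simp [blockHankel, truncMatrix, hankelSeries]

theorem HankelNonneg.isHermitian_truncMatrix {n : ℕ} {s : ℕ → Matrix (Fin q) (Fin q) ℂ}
    (h : HankelNonneg n s) : (truncMatrix (n + 1) (hankelSeries s)).IsHermitian := by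
  have h' := h.isHermitian.eq
  rw [blockHankel_eq_comp] at h'
  exact (comp _ _ _ _ _).injective h'

theorem posSemidef_comp_truncMatrix_mul_mul {N : ℕ} {Φ : (Matrix (Fin q) (Fin q) ℂ)⟦X⟧⟦X⟧}
    (h : (comp _ _ _ _ _ (truncMatrix N Φ)).PosSemidef) (G : (Matrix (Fin q) (Fin q) ℂ)⟦X⟧) :
    (comp _ _ _ _ _
      (truncMatrix N (C (starSeries G) * Φ * PowerSeries.map C G))).PosSemidef := by
  have := h.mul_mul_conjTranspose_same (comp _ _ _ _ _ (toeplitz N (starSeries G)))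
  rw [truncMatrix_mul_map_C, truncMatrix_C_mul, transpose_toeplitz]
  convert this
  exact ((compRingEquiv (Fin N) (Fin q) ℂ).map_mul _ _).trans
    (congrArg (· * _) ((compRingEquiv (Fin N) (Fin q) ℂ).map_mul _ _))

theorem HankelNonneg.blockHankel_mul_mpInv_mul_blockCol {n : ℕ}
    {s : ℕ → Matrix (Fin q) (Fin q) ℂ} (h : HankelNonneg (n + 1) s) :
    blockHankel s n * (mpInv (blockHankel s n) * blockCol s (n + 1) (n + 1)) =
      blockCol s (n + 1) (n + 1) := by
  have := submatrix_mul_mpInv_mul_of_posSemidef h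
    (fun a : Fin (n + 1) × Fin q => (a.1.castSucc, a.2)) (fun x : Fin q => (Fin.last (n + 1), x))
  have hcol : (blockHankel s (n + 1)).submatrix
      (fun a : Fin (n + 1) × Fin q => (a.1.castSucc, a.2))
      (fun x : Fin q => (Fin.last (n + 1), x)) = blockCol s (n + 1) (n + 1) := by
    ext a x
    simp [blockCol, blockHankel, add_comm]
  rw [hcol] at this
  rw [← Matrix.mul_assoc]
  exact this

theorem HankelNonneg.isSchurComplement_schurCompl {n : ℕ} {s : ℕ → Matrix (Fin q) (Fin q) ℂ}
    (h : HankelNonneg n s) :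
    IsSchurComplement (truncMatrix (n + 1) (hankelSeries s)) (schurCompl s n) := by
  rcases n with - | n
  · refine ⟨1, rfl, funext fun i => ?_⟩
    obtain rfl : i = Fin.last 0 := Fin.eq_zero i
    simp [truncMatrix, hankelSeries, schurCompl, mulVec, dotProduct]
  set W := mpInv (blockHankel s n) * blockCol s (n + 1) (n + 1) with hW
  have hrow (j : ℕ) (i : Fin q) (x : Fin q) :
      ((∑ k : Fin (n + 1), s (j + k) * of fun a b => W (k, a) b) : Matrix _ _ ℂ) i x =
        ∑ b : Fin (n + 1) × Fin q, s (j + b.1) i b.2 * W b x := by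
    simp [Matrix.sum_apply, Matrix.mul_apply, Fintype.sum_prod_type]
  refine ⟨Fin.snoc (fun k => -of fun a b => W (k, a) b) 1, Fin.snoc_last _ _, funext fun j => ?_⟩
  rw [mulVec, dotProduct, Fin.sum_univ_castSucc]
  simp only [truncMatrix, hankelSeries, of_apply, coeff_mk, Fin.snoc_castSucc, Fin.snoc_last,
    Fin.val_castSucc, Fin.val_last, mul_neg, mul_one, Finset.sum_neg_distrib, neg_add_eq_sub]
  cases j using Fin.lastCases with
  | last =>
    rw [Pi.single_eq_same, schurCompl, Matrix.mul_assoc, ← hW, Fin.val_last, two_mul]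
    congr 1
    ext i x
    exact hrow _ _ _
  | cast j =>
    rw [Pi.single_eq_of_ne (Fin.castSucc_ne_last j), sub_eq_zero]
    ext i x
    rw [hrow, Fin.val_castSucc, add_comm]
    exact (congrFun₂ h.blockHankel_mul_mpInv_mul_blockCol (j, i) x).symm

end Hankel

section Reciprocal

open PowerSeries

variable {q : ℕ} {u s : ℕ → Matrix (Fin q) (Fin q) ℂ}

theorem recipSeq_succ (u : ℕ → Matrix (Fin q) (Fin q) ℂ) (j : ℕ) :
    recipSeq u (j + 1) =
      -(mpInv (u 0) * ∑ l ∈ Finset.range (j + 1), u (j + 1 - l) * recipSeq u l) := by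
  rw [recipSeq, Finset.sum_range]

/-- The sequence `u` is dominated by its first term: the column space and the row space of every
`u j` are contained in those of `u 0`. -/
structure IsFirstTermDominant (u : ℕ → Matrix (Fin q) (Fin q) ℂ) : Prop where
  left (j : ℕ) : u 0 * mpInv (u 0) * u j = u j
  right (j : ℕ) : u j * (mpInv (u 0) * u 0) = u j

theorem isFirstTermDominant_plusTransform (hs : IsFirstTermDominant s) (α : ℂ) :
    IsFirstTermDominant (plusTransform α s) where
  left
    | 0 => (mpInv_spec _).mul_mul_left
    | j + 1 => by
      simp only [plusTransform, mul_add, mul_neg, mul_smul_comm, hs.left]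
  right
    | 0 => by rw [← mul_assoc]; exact (mpInv_spec _).mul_mul_left
    | j + 1 => by
      simp only [plusTransform, add_mul, neg_mul, smul_mul_assoc, hs.right]

theorem mk_mul_mk_recipSeq (hu : IsFirstTermDominant u) :
    mk u * mk (recipSeq u) = C (u 0 * mpInv (u 0)) := by
  ext1 (- | j)
  · simp [recipSeq]
  · rw [coeff_mul, ← Finset.Nat.sum_antidiagonal_swap,
      Finset.Nat.sum_antidiagonal_eq_sum_range_succ_mk, Finset.sum_range_succ]
    simp only [Prod.swap, coeff_mk, Nat.sub_self, coeff_succ_C]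
    rw [recipSeq_succ, mul_neg, ← mul_assoc, Finset.mul_sum]
    simp only [← mul_assoc, hu.left, add_neg_cancel]

/-- The normalization of the reciprocal series of `u` with constant term `1`, obtained by completing
`u♯(z) u_0` with the identity on the kernel of `u_0`. -/
noncomputable def recipFactor (u : ℕ → Matrix (Fin q) (Fin q) ℂ) :
    (Matrix (Fin q) (Fin q) ℂ)⟦X⟧ :=
  1 - C (mpInv (u 0) * u 0) + mk (recipSeq u) * C (u 0)

theorem coeff_zero_recipFactor (u : ℕ → Matrix (Fin q) (Fin q) ℂ) :
    coeff 0 (recipFactor u) = 1 := by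
  simp [recipFactor, recipSeq]

theorem C_mul_recipFactor (u : ℕ → Matrix (Fin q) (Fin q) ℂ) :
    C (u 0) * recipFactor u = C (u 0) * mk (recipSeq u) * C (u 0) := by
  rw [recipFactor, mul_add, mul_sub, mul_one, ← map_mul, ← mul_assoc (u 0),
    (mpInv_spec (u 0)).mul_mul_left, sub_self, zero_add, mul_assoc]

theorem mk_mul_recipFactor (hu : IsFirstTermDominant u) :
    mk u * recipFactor u = C (u 0) := by
  have hright : mk u * C (mpInv (u 0) * u 0) = mk u := by
    ext1 j
    rw [coeff_mul_C, coeff_mk, hu.right]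
  rw [recipFactor, mul_add, mul_sub, mul_one, hright, sub_self, zero_add, ← mul_assoc,
    mk_mul_mk_recipSeq hu, ← map_mul, (mpInv_spec (u 0)).mul_mul_left]

theorem starSeries_recipFactor_mul_mk (hu : IsFirstTermDominant u)
    (hH : ∀ j, (u j).IsHermitian) : starSeries (recipFactor u) * mk u = C (u 0) := by
  have hstar : starSeries (mk u) = mk u := by
    ext1 j
    simp only [starSeries, coeff_mk]
    exact (hH j).eq
  have h := congrArg starSeries (mk_mul_recipFactor hu)
  rwa [starSeries_mul, starSeries_C, hstar, star_eq_conjTranspose, (hH 0).eq] at h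

end Reciprocal

section SchurTransform

open PowerSeries

variable {q : ℕ} {α : ℝ} {s : ℕ → Matrix (Fin q) (Fin q) ℂ}

theorem C_mul_recipFactor_plusTransform (α : ℂ) (s : ℕ → Matrix (Fin q) (Fin q) ℂ) :
    C (s 0) * recipFactor (plusTransform α s) = C (s 0) - X * mk (schurTransform α s) := by
  have h : C (s 0) * recipFactor (plusTransform α s) =
      C (s 0) * mk (recipSeq (plusTransform α s)) * C (s 0) :=
    C_mul_recipFactor (plusTransform α s)
  rw [h]
  ext1 (- | j)
  · simpa [recipSeq, plusTransform] using (mpInv_spec (s 0)).mul_mul_left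
  · simp [schurTransform, coeff_succ_X_mul, coeff_succ_C]

theorem mk_plusTransform (α : ℂ) (s : ℕ → Matrix (Fin q) (Fin q) ℂ) :
    mk (plusTransform α s) = C (s 0) + X * mk (rightShift α s) := by
  ext1 (- | j)
  · simp [plusTransform]
  · simp [plusTransform, rightShift, coeff_succ_X_mul, coeff_succ_C]

theorem mk_plusTransform_eq_mul (α : ℂ) (s : ℕ → Matrix (Fin q) (Fin q) ℂ) :
    mk (plusTransform α s) = (1 - α • X) * mk s := by
  ext1 (- | j)
  · simp [plusTransform, sub_mul]
  · simp [plusTransform, sub_mul, coeff_succ_X_mul, neg_add_eq_sub]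

theorem one_sub_smul_X_mul (α : ℂ) (c : Matrix (Fin q) (Fin q) ℂ)
    (t : ℕ → Matrix (Fin q) (Fin q) ℂ) :
    (1 - α • X) * (C c - X * mk t) =
      C c - X * C (α • c + t 0) - X ^ 2 * mk (rightShift α t) := by
  ext1 (- | - | j)
  · simp [sub_mul, pow_two, mul_assoc]
  · simp [sub_mul, pow_two, mul_assoc, coeff_succ_X_mul, coeff_succ_C, ← sub_eq_add_neg, sub_sub,
      add_comm]
  · simp [sub_mul, pow_two, mul_assoc, coeff_succ_X_mul, coeff_succ_C, rightShift]

theorem isHermitian_plusTransform (hH : ∀ j, (s j).IsHermitian) :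
    ∀ j, (plusTransform (α : ℂ) s j).IsHermitian
  | 0 => hH 0
  | j + 1 => ((hH j).smul (Complex.conj_ofReal α)).neg.add (hH (j + 1))

theorem recipFactor_mul_hankelSeries_rightShift_mul (hs : IsFirstTermDominant s)
    (hH : ∀ j, (s j).IsHermitian) :
    C (starSeries (recipFactor (plusTransform (α : ℂ) s))) *
        hankelSeries (rightShift (α : ℂ) s) *
        PowerSeries.map C (recipFactor (plusTransform (α : ℂ) s)) =
      hankelSeries (schurTransform (α : ℂ) s) := by
  have hu := isFirstTermDominant_plusTransform hs α
  apply mul_hankelSeries_mul_of_add_X_mul (c := s 0)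
  · rw [← mk_plusTransform]
    exact starSeries_recipFactor_mul_mk hu (isHermitian_plusTransform hH)
  · rw [← mk_plusTransform]
    exact mk_mul_recipFactor hu
  · exact C_mul_recipFactor_plusTransform α s

theorem C_mul_recipFactor_eq_sub_mk_rightShift (hs : IsFirstTermDominant s)
    (hH : ∀ j, (s j).IsHermitian) (α : ℝ) :
    C (s 0) * recipFactor s =
      C (s 0) - X * C ((α : ℂ) • s 0 + schurTransform (α : ℂ) s 0) -
        X ^ 2 * mk (rightShift (α : ℂ) (schurTransform (α : ℂ) s)) := by
  set U := plusTransform (α : ℂ) s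
  set F := starSeries (recipFactor U)
  have hdom : IsFirstTermDominant U := isFirstTermDominant_plusTransform hs α
  have hFU : F * mk U = C (s 0) :=
    starSeries_recipFactor_mul_mk hdom (isHermitian_plusTransform hH)
  have hUG : mk U * recipFactor U = C (s 0) := mk_mul_recipFactor hdom
  have hcomm : Commute F (1 - (α : ℂ) • X) :=
    (Commute.one_right F).sub_right ((commute_X F).smul_right _)
  calc C (s 0) * recipFactor s = F * ((1 - (α : ℂ) • X) * mk s) * recipFactor s := by
        rw [← mk_plusTransform_eq_mul, hFU]
    _ = (1 - (α : ℂ) • X) * (F * (mk s * recipFactor s)) := by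
        rw [hcomm.left_comm, mul_assoc, mul_assoc]
    _ = (1 - (α : ℂ) • X) * (F * mk U * recipFactor U) := by
        rw [mk_mul_recipFactor hs, mul_assoc, hUG]
    _ = (1 - (α : ℂ) • X) * (C (s 0) - X * mk (schurTransform (α : ℂ) s)) := by
        rw [hFU, C_mul_recipFactor_plusTransform]
    _ = _ := one_sub_smul_X_mul _ _ _

theorem recipFactor_mul_hankelSeries_mul (hs : IsFirstTermDominant s)
    (hH : ∀ j, (s j).IsHermitian) (α : ℝ) :
    C (starSeries (recipFactor s)) * hankelSeries s * PowerSeries.map C (recipFactor s) =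
      C (C (s 0)) + C X * X * hankelSeries (rightShift (α : ℂ) (schurTransform (α : ℂ) s)) :=
  mul_hankelSeries_mul_of_mul_mk (starSeries_recipFactor_mul_mk hs hH) (mk_mul_recipFactor hs)
    (C_mul_recipFactor_eq_sub_mk_rightShift hs hH α)

end SchurTransform


section HankelSchurTransform

open PowerSeries

variable {q n : ℕ} {α : ℝ} {s : ℕ → Matrix (Fin q) (Fin q) ℂ}

theorem truncMatrix_C_add_C_X_mul_X_mul_zero_succ {R : Type*} [Ring R] (n : ℕ) (c : R)
    (Φ : R⟦X⟧⟦X⟧) (k : Fin n) :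
    truncMatrix (n + 1) (C (C c) + C X * X * Φ) 0 k.succ = 0 := by
  simp [truncMatrix, mul_assoc, coeff_succ_C]

theorem truncMatrix_C_add_C_X_mul_X_mul_submatrix_succ {R : Type*} [Ring R] (n : ℕ) (c : R)
    (Φ : R⟦X⟧⟦X⟧) :
    (truncMatrix (n + 1) (C (C c) + C X * X * Φ)).submatrix Fin.succ Fin.succ =
      truncMatrix n Φ := by
  ext j k
  simp [truncMatrix, mul_assoc, coeff_succ_C, coeff_succ_X_mul]

theorem coeff_zero_starSeries_recipFactor (u : ℕ → Matrix (Fin q) (Fin q) ℂ) :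
    coeff 0 (starSeries (recipFactor u)) = 1 := by
  rw [starSeries, coeff_mk, coeff_zero_recipFactor, star_one]

theorem hankelNonneg_schurTransform (hs : IsFirstTermDominant s) (hH : ∀ j, (s j).IsHermitian)
    (h : HankelNonneg n (rightShift (α : ℂ) s)) :
    HankelNonneg n (schurTransform (α : ℂ) s) := by
  rw [HankelNonneg, blockHankel_eq_comp] at h ⊢
  rw [← recipFactor_mul_hankelSeries_rightShift_mul hs hH]
  exact posSemidef_comp_truncMatrix_mul_mul h _

theorem schurCompl_schurTransform (hs : IsFirstTermDominant s) (hH : ∀ j, (s j).IsHermitian)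
    (h : HankelNonneg n (rightShift (α : ℂ) s)) :
    schurCompl (schurTransform (α : ℂ) s) n = schurCompl (rightShift (α : ℂ) s) n := by
  refine IsSchurComplement.unique h.isHermitian_truncMatrix ?_ h.isSchurComplement_schurCompl
  refine .of_mul_mul (coeff_zero_starSeries_recipFactor (plusTransform (α : ℂ) s))
    (coeff_zero_recipFactor (plusTransform (α : ℂ) s)) ?_
  rw [recipFactor_mul_hankelSeries_rightShift_mul hs hH]
  exact (hankelNonneg_schurTransform hs hH h).isSchurComplement_schurCompl

theorem hankelNonneg_rightShift_schurTransform (hs : IsFirstTermDominant s)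
    (hH : ∀ j, (s j).IsHermitian) (α : ℝ) (h : HankelNonneg (n + 1) s) :
    HankelNonneg n (rightShift (α : ℂ) (schurTransform (α : ℂ) s)) := by
  rw [HankelNonneg, blockHankel_eq_comp] at h ⊢
  have h' := posSemidef_comp_truncMatrix_mul_mul h (recipFactor s)
  rw [recipFactor_mul_hankelSeries_mul hs hH α] at h'
  rw [← truncMatrix_C_add_C_X_mul_X_mul_submatrix_succ _ (s 0)]
  exact h'.submatrix (Prod.map Fin.succ id)

theorem schurCompl_rightShift_schurTransform (hs : IsFirstTermDominant s)
    (hH : ∀ j, (s j).IsHermitian) (α : ℝ) (h : HankelNonneg (n + 1) s) :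
    schurCompl (rightShift (α : ℂ) (schurTransform (α : ℂ) s)) n = schurCompl s (n + 1) := by
  refine IsSchurComplement.unique h.isHermitian_truncMatrix ?_ h.isSchurComplement_schurCompl
  refine .of_mul_mul (coeff_zero_starSeries_recipFactor s) (coeff_zero_recipFactor s) ?_
  rw [recipFactor_mul_hankelSeries_mul hs hH α]
  refine .of_submatrix_succ (truncMatrix_C_add_C_X_mul_X_mul_zero_succ _ _ _) ?_
  rw [truncMatrix_C_add_C_X_mul_X_mul_submatrix_succ]
  exact (hankelNonneg_rightShift_schurTransform hs hH α h).isSchurComplement_schurCompl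

end HankelSchurTransform

section StieltjesNonneg

variable {q m n : ℕ} {α : ℝ} {s s' : ℕ → Matrix (Fin q) (Fin q) ℂ}

theorem HankelNonneg.mono {n' : ℕ} (h : HankelNonneg n s) (hn : n' ≤ n) : HankelNonneg n' s :=
  h.submatrix (Prod.map (Fin.castLE (Nat.succ_le_succ hn)) id)

theorem HankelNonneg.congr (h : HankelNonneg n s) (hs : ∀ j ≤ 2 * n, s j = s' j) :
    HankelNonneg n s' := by
  have : blockHankel s n = blockHankel s' n := by
    ext a b
    rw [blockHankel, hs _ (by omega), blockHankel]
  rwa [HankelNonneg, ← this]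

theorem HankelNonneg.isHermitian_two_mul (h : HankelNonneg n s) : (s (2 * n)).IsHermitian := by
  have := h.isHermitian_truncMatrix.apply (Fin.last n) (Fin.last n)
  simpa [truncMatrix, hankelSeries, two_mul, star_eq_conjTranspose, IsHermitian] using this

theorem HankelNonneg.mul_eq_zero (h : HankelNonneg n s) {i k : ℕ} (hi : i ≤ n) (hk : k ≤ n)
    {P : Matrix (Fin q) (Fin q) ℂ} (hP : s (i + i) * P = 0) : s (k + i) * P = 0 :=
  submatrix_mul_eq_zero_of_posSemidef h
    (φ := fun x => (⟨i, Nat.lt_succ_of_le hi⟩, x)) hP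
    (fun x : Fin q => (⟨k, Nat.lt_succ_of_le hk⟩, x))

theorem StieltjesNonneg.hankel (h : StieltjesNonneg α m s) (hn : 2 * n ≤ m) :
    HankelNonneg n s := by
  rcases Nat.even_or_odd' m with ⟨l, rfl | rfl⟩
  · exact (h.1 l rfl).1.mono (by omega)
  · exact (h.2 l rfl).1.mono (by omega)

theorem StieltjesNonneg.hankel_rightShift (h : StieltjesNonneg α m s) (hn : 2 * n + 1 ≤ m) :
    HankelNonneg n (rightShift (α : ℂ) s) := by
  rcases Nat.even_or_odd' m with ⟨l, rfl | rfl⟩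
  · exact ((h.1 l rfl).2 (by omega)).mono (by omega)
  · exact (h.2 l rfl).2.mono (by omega)

theorem StieltjesNonneg.of_hankel (h : ∀ n, 2 * n ≤ m → HankelNonneg n s)
    (h' : ∀ n, 2 * n + 1 ≤ m → HankelNonneg n (rightShift (α : ℂ) s)) :
    StieltjesNonneg α m s :=
  ⟨fun n hn => ⟨h n hn.ge, fun _ => h' (n - 1) (by omega)⟩,
    fun n hn => ⟨h n (by omega), h' n hn.ge⟩⟩

theorem rightShift_congr (c : ℂ) (h : ∀ j ≤ m, s j = s' j) {j : ℕ} (hj : j < m) :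
    rightShift c s j = rightShift c s' j := by
  rw [rightShift, rightShift, h j hj.le, h (j + 1) hj]

theorem StieltjesNonneg.congr (h : StieltjesNonneg α m s) (hs : ∀ j ≤ m, s j = s' j) :
    StieltjesNonneg α m s' :=
  .of_hankel (fun _ hn => (h.hankel hn).congr fun j hj => hs j (hj.trans hn))
    fun _ hn => (h.hankel_rightShift hn).congr fun _ hj => rightShift_congr _ hs (by omega)

theorem StieltjesNonneg.isHermitian (h : StieltjesNonneg α m s) {j : ℕ} (hj : j ≤ m) :
    (s j).IsHermitian := by
  rcases Nat.even_or_odd' j with ⟨l, rfl | rfl⟩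
  · exact (h.hankel hj).isHermitian_two_mul
  · have hshift := (h.hankel_rightShift hj).isHermitian_two_mul
    have heven := (h.hankel (n := l) (by omega)).isHermitian_two_mul
    simpa [rightShift] using hshift.add (heven.smul (Complex.conj_ofReal α))

-- Positivity of the Hankel matrix of `s` passes from an even index to the next one, positivity of
-- the Hankel matrix of the shift from an odd one.
theorem StieltjesNonneg.mul_eq_zero (h : StieltjesNonneg α m s) {P : Matrix (Fin q) (Fin q) ℂ}
    (hP : s 0 * P = 0) {j : ℕ} (hj : j < m) : s j * P = 0 := by
  induction j using Nat.strong_induction_on with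
  | _ j ih =>
    rcases Nat.even_or_odd' j with ⟨i, rfl | rfl⟩
    · rcases i with - | i
      · exact hP
      · have hodd : s (i + 1 + i) * P = 0 := ih _ (by omega) (by omega)
        have hshift : rightShift (α : ℂ) s (i + i) * P = 0 := by
          rw [rightShift, add_mul, neg_mul, smul_mul_assoc, ih _ (by omega) (by omega),
            add_right_comm, hodd, smul_zero, neg_zero, add_zero]
        have hnext := (h.hankel_rightShift (n := i + 1) (by omega)).mul_eq_zero
          (Nat.le_succ i) le_rfl hshift
        rw [rightShift, add_mul, neg_mul, smul_mul_assoc, hodd, smul_zero, neg_zero,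
          zero_add] at hnext
        rwa [two_mul, ← add_assoc]
    · have heven : s (i + i) * P = 0 := ih _ (by omega) (by omega)
      have hnext := (h.hankel (n := i + 1) (by omega)).mul_eq_zero (Nat.le_succ i) le_rfl heven
      rwa [two_mul, add_right_comm]

theorem StieltjesNonneg.mul_mpInv_mul (h : StieltjesNonneg α m s) {j : ℕ} (hj : j < m) :
    s j * (mpInv (s 0) * s 0) = s j := by
  have hP : s 0 * (1 - mpInv (s 0) * s 0) = 0 := by
    rw [mul_sub, mul_one, ← mul_assoc, (mpInv_spec (s 0)).mul_mul_left, sub_self]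
  have hj' := h.mul_eq_zero hP hj
  rw [mul_sub, mul_one, sub_eq_zero] at hj'
  exact hj'.symm

end StieltjesNonneg

section Param

variable {p q n : ℕ} {s s' : ℕ → Matrix (Fin p) (Fin q) ℂ}

theorem schurCompl_sub_congr (h : ∀ j < 2 * n, s j = s' j) :
    schurCompl s n - s (2 * n) = schurCompl s' n - s' (2 * n) := by
  rcases n with - | n
  · simp [schurCompl]
  · have hHankel : blockHankel s n = blockHankel s' n := by
      ext a b
      rw [blockHankel, h _ (by omega), blockHankel]
    have hRow : blockRow s (n + 1) (n + 1) = blockRow s' (n + 1) (n + 1) := by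
      ext a b
      rw [blockRow, h _ (by omega), blockRow]
    have hCol : blockCol s (n + 1) (n + 1) = blockCol s' (n + 1) (n + 1) := by
      ext a b
      rw [blockCol, h _ (by omega), blockCol]
    simp only [schurCompl, hHankel, hRow, hCol, sub_sub_cancel_left]

theorem stieltjesParam_two_mul (c : ℂ) (s : ℕ → Matrix (Fin p) (Fin q) ℂ) (n : ℕ) :
    stieltjesParam c s (2 * n) = schurCompl s n := by
  simp [stieltjesParam]

theorem stieltjesParam_two_mul_add_one (c : ℂ) (s : ℕ → Matrix (Fin p) (Fin q) ℂ) (n : ℕ) :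
    stieltjesParam c s (2 * n + 1) = schurCompl (rightShift c s) n := by
  rw [stieltjesParam, if_neg (Nat.not_even_bit1 n)]
  congr 1
  omega

theorem stieltjesParam_sub_congr (c : ℂ) {j : ℕ} (h : ∀ i < j, s i = s' i) :
    stieltjesParam c s j - s j = stieltjesParam c s' j - s' j := by
  rcases Nat.even_or_odd' j with ⟨n, rfl | rfl⟩
  · rw [stieltjesParam_two_mul, stieltjesParam_two_mul]
    exact schurCompl_sub_congr h
  · rw [stieltjesParam_two_mul_add_one, stieltjesParam_two_mul_add_one]
    have hshift := schurCompl_sub_congr (s := rightShift c s) (s' := rightShift c s') (n := n)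
      fun i hi => by rw [rightShift, h i (by omega), h (i + 1) (by omega), rightShift]
    simp only [rightShift, h (2 * n) (by omega), sub_add_eq_sub_sub_swap, sub_left_inj] at hshift
    exact hshift

theorem stieltjesParam_congr (c : ℂ) {j : ℕ} (h : ∀ i ≤ j, s i = s' i) :
    stieltjesParam c s j = stieltjesParam c s' j := by
  have := stieltjesParam_sub_congr c fun i hi => h i hi.le
  rwa [h j le_rfl, sub_left_inj] at this

end Param

section Compression

variable {q m n : ℕ} {α : ℝ} {s u u' : ℕ → Matrix (Fin q) (Fin q) ℂ}

/-- The compression `s₀ s₀† s_j s₀† s₀` of `s 0, …, s m` to the range of `s 0`. It is continued by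
zero, because the values of `s` beyond `m` are irrelevant and need not be Hermitian. -/
noncomputable def compression (s : ℕ → Matrix (Fin q) (Fin q) ℂ) (m j : ℕ) :
    Matrix (Fin q) (Fin q) ℂ :=
  if j ≤ m then s 0 * mpInv (s 0) * s j * (mpInv (s 0) * s 0) else 0

theorem compression_of_le (s : ℕ → Matrix (Fin q) (Fin q) ℂ) {j : ℕ} (hj : j ≤ m) :
    compression s m j = s 0 * mpInv (s 0) * s j * (mpInv (s 0) * s 0) :=
  if_pos hj

theorem compression_zero (s : ℕ → Matrix (Fin q) (Fin q) ℂ) (m : ℕ) :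
    compression s m 0 = s 0 := by
  rw [compression_of_le s m.zero_le, (mpInv_spec _).mul_mul_left, ← mul_assoc,
    (mpInv_spec _).mul_mul_left]

theorem isFirstTermDominant_compression (s : ℕ → Matrix (Fin q) (Fin q) ℂ) (m : ℕ) :
    IsFirstTermDominant (compression s m) where
  left j := by
    rw [compression_zero, compression]
    split_ifs
    · simp only [← mul_assoc, (mpInv_spec (s 0)).mul_mul_left]
    · rw [mul_zero]
  right j := by
    rw [compression_zero, compression]
    split_ifs
    · rw [mul_assoc _ (mpInv (s 0) * s 0), ← mul_assoc (mpInv (s 0) * s 0),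
        (mpInv_spec (s 0)).mul_mul_right]
    · rw [zero_mul]

theorem StieltjesNonneg.isHermitian_compression (h : StieltjesNonneg α m s) (j : ℕ) :
    (compression s m j).IsHermitian := by
  rw [compression]
  split_ifs with hj
  · rw [mul_mpInv_comm_of_isHermitian (h.isHermitian m.zero_le)]
    nth_rewrite 1 [← (mpInv_spec (s 0)).hermitian_right]
    exact isHermitian_conjTranspose_mul_mul _ (h.isHermitian hj)
  · exact isHermitian_zero

theorem HankelNonneg.conjTranspose_mul_mul (h : HankelNonneg n s)
    (E : Matrix (Fin q) (Fin q) ℂ) : HankelNonneg n fun j => Eᴴ * s j * E := by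
  rw [HankelNonneg, blockHankel_eq_comp] at h ⊢
  have h' := posSemidef_comp_truncMatrix_mul_mul h (PowerSeries.C E)
  rw [starSeries_C, star_eq_conjTranspose, PowerSeries.map_C] at h'
  convert h'
  ext1 k
  ext1 j
  simp [hankelSeries, mul_assoc]

theorem StieltjesNonneg.compression (h : StieltjesNonneg α m s) :
    StieltjesNonneg α m (compression s m) := by
  have hEs (E : Matrix (Fin q) (Fin q) ℂ) : StieltjesNonneg α m fun j => Eᴴ * s j * E := by
    refine .of_hankel (fun n hn => (h.hankel hn).conjTranspose_mul_mul E) fun n hn => ?_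
    convert (h.hankel_rightShift hn).conjTranspose_mul_mul E using 1
    funext j
    simp only [rightShift, mul_add, add_mul, mul_neg, neg_mul, mul_smul_comm, smul_mul_assoc]
  refine (hEs (mpInv (s 0) * s 0)).congr fun j hj => ?_
  rw [compression_of_le s hj, mul_mpInv_comm_of_isHermitian (h.isHermitian m.zero_le),
    (mpInv_spec (s 0)).hermitian_right]

theorem StieltjesNonneg.compression_eq (h : StieltjesNonneg α m s) {j : ℕ} (hj : j < m) :
    StieltjesSchur.compression s m j = s j := by
  have hleft : s 0 * mpInv (s 0) * s j = s j := by
    have := congrArg conjTranspose (h.mul_mpInv_mul hj)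
    rwa [conjTranspose_mul, (mpInv_spec (s 0)).hermitian_right, (h.isHermitian hj.le).eq,
      ← mul_mpInv_comm_of_isHermitian (h.isHermitian m.zero_le)] at this
  rw [compression_of_le s hj.le, hleft, h.mul_mpInv_mul hj]

theorem defectTerm_zero (c : ℂ) (s : ℕ → Matrix (Fin q) (Fin q) ℂ) (m : ℕ) :
    defectTerm c s m 0 = s m - compression s m m := by
  rw [defectTerm, schurIter, compression_of_le s le_rfl, mul_assoc _ (mpInv (s 0))]

theorem mpInv_mul_mul_recipSeq (u : ℕ → Matrix (Fin q) (Fin q) ℂ) :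
    ∀ j, mpInv (u 0) * u 0 * recipSeq u j = recipSeq u j
  | 0 => by rw [recipSeq, (mpInv_spec _).mul_mul_right]
  | j + 1 => by rw [recipSeq_succ, mul_neg, ← mul_assoc, (mpInv_spec _).mul_mul_right]

theorem recipSeq_eq_of_eq_compression
    (h : ∀ j ≤ m, u' j = u 0 * mpInv (u 0) * u j * (mpInv (u 0) * u 0)) {j : ℕ} (hj : j ≤ m) :
    recipSeq u' j = recipSeq u j := by
  have hzero : u' 0 = u 0 := by
    rw [h 0 m.zero_le, (mpInv_spec _).mul_mul_left, ← mul_assoc, (mpInv_spec _).mul_mul_left]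
  induction j using Nat.strong_induction_on with
  | _ j ih =>
    rcases j with - | j
    · rw [recipSeq, recipSeq, hzero]
    · rw [recipSeq_succ, recipSeq_succ, hzero, Finset.mul_sum, Finset.mul_sum, neg_inj]
      refine Finset.sum_congr rfl fun l hl => ?_
      have hlj : l < j + 1 := Finset.mem_range.1 hl
      rw [ih l hlj (by omega), h _ (by omega), mul_assoc (_ * u _), mpInv_mul_mul_recipSeq]
      simp only [← mul_assoc, (mpInv_spec (u 0)).mul_mul_right]

theorem schurTransform_compression (c : ℂ) (s : ℕ → Matrix (Fin q) (Fin q) ℂ) {j : ℕ}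
    (hj : j < m) : schurTransform c (compression s m) j = schurTransform c s j := by
  rw [schurTransform, schurTransform, compression_zero]
  congr 3
  refine recipSeq_eq_of_eq_compression (m := m) (fun i hi => ?_) hj
  rcases i with - | i
  · exact compression_of_le s hi
  · simp only [plusTransform, compression_of_le s hi, compression_of_le s (Nat.le_of_succ_le hi),
      mul_add, add_mul, mul_neg, neg_mul, mul_smul_comm, smul_mul_assoc]

end Compression

section SchurStep

variable {q m : ℕ} {α : ℝ} {s : ℕ → Matrix (Fin q) (Fin q) ℂ}

theorem StieltjesNonneg.schurTransform_of_isFirstTermDominant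
    (h : StieltjesNonneg α (m + 1) s) (hs : IsFirstTermDominant s)
    (hH : ∀ j, (s j).IsHermitian) : StieltjesNonneg α m (schurTransform (α : ℂ) s) :=
  .of_hankel (fun _ hn => hankelNonneg_schurTransform hs hH (h.hankel_rightShift (by omega)))
    fun _ hn => hankelNonneg_rightShift_schurTransform hs hH α (h.hankel (by omega))

theorem StieltjesNonneg.stieltjesParam_schurTransform_of_isFirstTermDominant
    (h : StieltjesNonneg α (m + 1) s) (hs : IsFirstTermDominant s)
    (hH : ∀ j, (s j).IsHermitian) {j : ℕ} (hj : j ≤ m) :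
    stieltjesParam (α : ℂ) (schurTransform (α : ℂ) s) j = stieltjesParam (α : ℂ) s (j + 1) := by
  rcases Nat.even_or_odd' j with ⟨n, rfl | rfl⟩
  · rw [stieltjesParam_two_mul, stieltjesParam_two_mul_add_one]
    exact schurCompl_schurTransform hs hH (h.hankel_rightShift (by omega))
  · rw [stieltjesParam_two_mul_add_one, show 2 * n + 1 + 1 = 2 * (n + 1) by ring,
      stieltjesParam_two_mul]
    exact schurCompl_rightShift_schurTransform hs hH α (h.hankel (by omega))

theorem StieltjesNonneg.schurTransform (h : StieltjesNonneg α (m + 1) s) :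
    StieltjesNonneg α m (schurTransform (α : ℂ) s) :=
  (h.compression.schurTransform_of_isFirstTermDominant (isFirstTermDominant_compression s _)
    h.isHermitian_compression).congr
    fun _ hj => schurTransform_compression _ _ (Nat.lt_succ_of_le hj)

theorem StieltjesNonneg.stieltjesParam_schurTransform_eq_compression
    (h : StieltjesNonneg α (m + 1) s) {j : ℕ} (hj : j ≤ m) :
    stieltjesParam (α : ℂ) (StieltjesSchur.schurTransform (α : ℂ) s) j =
      stieltjesParam (α : ℂ) (StieltjesSchur.compression s (m + 1)) (j + 1) := by
  rw [← h.compression.stieltjesParam_schurTransform_of_isFirstTermDominant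
    (isFirstTermDominant_compression s _) h.isHermitian_compression hj]
  exact stieltjesParam_congr _ fun i hi =>
    (schurTransform_compression _ _ (Nat.lt_succ_of_le (hi.trans hj))).symm

theorem StieltjesNonneg.stieltjesParam_schurTransform (h : StieltjesNonneg α (m + 1) s) {j : ℕ}
    (hj : j < m) :
    stieltjesParam (α : ℂ) (StieltjesSchur.schurTransform (α : ℂ) s) j =
      stieltjesParam (α : ℂ) s (j + 1) := by
  rw [h.stieltjesParam_schurTransform_eq_compression hj.le]
  exact stieltjesParam_congr _ fun i hi => h.compression_eq (by omega)

theorem StieltjesNonneg.stieltjesParam_schurTransform_last (h : StieltjesNonneg α (m + 1) s) :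
    stieltjesParam (α : ℂ) (StieltjesSchur.schurTransform (α : ℂ) s) m =
      stieltjesParam (α : ℂ) s (m + 1) - defectTerm (α : ℂ) s (m + 1) 0 := by
  have hsub := stieltjesParam_sub_congr (α : ℂ) fun i (hi : i < m + 1) => h.compression_eq hi
  rw [h.stieltjesParam_schurTransform_eq_compression le_rfl, defectTerm_zero,
    sub_eq_iff_eq_add.1 hsub]
  abel

end SchurStep

theorem schurIter_succ' {p q : ℕ} (c : ℂ) (s : ℕ → Matrix (Fin p) (Fin q) ℂ) (k : ℕ) :
    schurIter c s (k + 1) = schurIter c (schurTransform c s) k := by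
  induction k with
  | zero => rfl
  | succ k ih => rw [schurIter, ih, schurIter]

theorem defectTerm_succ {p q : ℕ} (c : ℂ) (s : ℕ → Matrix (Fin p) (Fin q) ℂ) (j k : ℕ) :
    defectTerm c s j (k + 1) = defectTerm c (schurTransform c s) j k := by
  rw [defectTerm, defectTerm, schurIter_succ']

end StieltjesSchur

theorem theoremT1000 (q : ℕ) (α : ℝ) (m : ℕ) (s : ℕ → Matrix (Fin q) (Fin q) ℂ)
    (hs : StieltjesSchur.StieltjesNonneg α m s) (k : ℕ) (hk : k ≤ m) :
    (∀ j : ℕ, k + j < m →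
      StieltjesSchur.stieltjesParam (α : ℂ) (StieltjesSchur.schurIter (α : ℂ) s k) j =
        StieltjesSchur.stieltjesParam (α : ℂ) s (k + j)) ∧
    StieltjesSchur.stieltjesParam (α : ℂ) (StieltjesSchur.schurIter (α : ℂ) s k) (m - k) =
      StieltjesSchur.stieltjesParam (α : ℂ) s m -
        ∑ r ∈ Finset.range k, StieltjesSchur.defectTerm (α : ℂ) s (m - r) r := by
  induction k generalizing m s with
  | zero => simp [StieltjesSchur.schurIter]
  | succ k ih =>
    obtain ⟨m, rfl⟩ : ∃ m', m = m' + 1 := ⟨m - 1, by omega⟩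
    obtain ⟨hparam, hlast⟩ := ih m _ hs.schurTransform (by omega)
    rw [StieltjesSchur.schurIter_succ']
    refine ⟨fun j hj => ?_, ?_⟩
    · rw [hparam j (by omega), hs.stieltjesParam_schurTransform (by omega), add_right_comm]
    · rw [Nat.add_sub_add_right, hlast, hs.stieltjesParam_schurTransform_last,
        Finset.sum_range_succ', Nat.sub_zero]
      simp only [StieltjesSchur.defectTerm_succ, Nat.add_sub_add_right]
      abel
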